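/- **Theorem (Rates for AVaR, OCE, and SF).** Let $l\colon\mathbb{R}\to[0,\infty)$ be a loss function, i.e. increasing (not necessarily strictly), convex, and with $1\in\partial l(0)$, that is, $l(x)\ge l(0)+x$ for all $x\in\mathbb{R}$. For a probability measure $\mu$ on a measurable space $\mathcal{X}$ and a bounded measurable $H\colon\mathcal{X}\to\mathbb{R}$ set $$\mathrm{OCE}^\mu(H)=\inf_{m\in\mathbb{R}}\Big(\int l(H-m)\,d\mu+m\Big),\qquad \mathrm{SF}^\mu(H)=\inf\Big\{m\in\mathbb{R}:\int l(H-m)\,d\mu\le 1\Big\}.$$ Let $\rho=\mathrm{OCE}$ or $\rho=\mathrm{SF}$; in the latter case assume that $l$ is strictly increasing and that $l(x)\le 1$ for some $x\in\mathbb{R}$ (so that $\mathrm{SF}$ is finite). (The average value at risk at level $u\in[0,1)$ is the OCE with $l(x)=x^+/(1-u)$.) For measurable $F,G_1,\dots,G_e\colon\mathcal{X}\to\mathbb{R}$, $e\in\mathbb{N}$, prices $p\in\mathbb{R}^e$ and a nonempty set $\mathcal{G}\subset\mathbb{R}^e$ of strategies define $$\pi^\mu(F)=\inf_{g\in\mathcal{G}}\rho^\mu\Big(F+\sum_{i=1}^e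 g_i(G_i-p_i)\Big).$$ Let $K_F,K_G,R\in\mathbb{R}$. Then there are constants $c,C>0$, depending only on $\rho$ (OCE or SF), $l$, $K_F$, $K_G$ and $R$, such that the following holds for every $e$, every measurable space $\mathcal{X}$, every probability measure $\mu$ on $\mathcal{X}$, all measurable $F,G_1,\dots,G_e$ with $|F|\le K_F$ and $\sum_{i=1}^e|G_i|\le K_G$ on $\mathcal{X}$, all $p\in\mathbb{R}^e$, and every nonempty $\mathcal{G}\subset\{g\in\mathbb{R}^e:|g|\le R\}$ (Euclidean norm). Let $S_1,S_2,\dots$ be i.i.d. random variables with law $\mu$ on a probability space $(\Omega,P)$, and let $\mu_N=\frac1N\sum_{n=1}^N\delta_{S_n}$. Then (i) for all $N\ge 1$, $|\pi^\mu(F)-\pi^{\mu_N}(F)|$ is integrable and $$E\big[|\pi^\mu(F)-\pi^{\mu_N}(F)|\big]\le\frac{C}{\sqrt N};$$ (ii) for all $N\ge 1$ and all $\varepsilon>0$, $$P\big[|\pi^\mu(F)-\pi^{\mu_N}(F)|\ge\varepsilon\big]\le C\exp(-cN\varepsilon^2).$$ In particular, once $K_F$, $K_G$ and $R$ are fixed,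 the constants depend neither on $\mathcal{X}$ (or its dimension) nor on the number $e$ of options. -/

import Mathlib

open MeasureTheory ProbabilityTheory

/-- A loss function: `l : ℝ → ℝ₊` increasing (in the weak sense), convex, with `1 ∈ ∂l(0)`. -/
structure IsLossFunction (l : ℝ → ℝ) : Prop where
  nonneg : ∀ x, 0 ≤ l x
  mono : Monotone l
  convex : ConvexOn ℝ Set.univ l
  one_mem_subdifferential : ∀ x, l 0 + 1 * (x - 0) ≤ l x

/-- The optimized certainty equivalent `inf_m (E^μ[l(F - m)] + m)`. -/
noncomputable def optimizedCertaintyEquivalent (l : ℝ → ℝ) {𝒳 : Type*} [MeasurableSpace 𝒳]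
    (μ : Measure 𝒳) (F : 𝒳 → ℝ) : ℝ :=
  ⨅ m : ℝ, ((∫ x, l (F x - m) ∂μ) + m)

/-- The shortfall risk `inf {m | E^μ[l(F - m)] ≤ 1}`. -/
noncomputable def shortfallRisk (l : ℝ → ℝ) {𝒳 : Type*} [MeasurableSpace 𝒳]
    (μ : Measure 𝒳) (F : 𝒳 → ℝ) : ℝ :=
  sInf {m : ℝ | ∫ x, l (F x - m) ∂μ ≤ 1}

/-- The two families of risk measures: optimized certainty equivalents and shortfall risks. -/
inductive RiskKind : Type
  | oce : RiskKind
  | sf : RiskKind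

/-- The risk `ρ^μ(F)` with loss function `l`, where `ρ` is OCE or SF. -/
noncomputable def riskMeasure (k : RiskKind) (l : ℝ → ℝ) {𝒳 : Type*} [MeasurableSpace 𝒳]
    (μ : Measure 𝒳) (F : 𝒳 → ℝ) : ℝ :=
  match k with
  | .oce => optimizedCertaintyEquivalent l μ F
  | .sf => shortfallRisk l μ F

/-- The hedged risk `π^μ(F) = inf_{g ∈ 𝒢} ρ^μ(F + ∑ i, g_i (G_i - p_i))`. -/
noncomputable def hedgedRisk (k : RiskKind) (l : ℝ → ℝ) {e : ℕ} {𝒳 : Type*} [MeasurableSpace 𝒳]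
    (G : Fin e → 𝒳 → ℝ) (p : Fin e → ℝ) (𝒢 : Set (EuclideanSpace ℝ (Fin e)))
    (μ : Measure 𝒳) (F : 𝒳 → ℝ) : ℝ :=
  ⨅ g : 𝒢, riskMeasure k l μ
    (fun x => F x + ∑ i, (g : EuclideanSpace ℝ (Fin e)) i * (G i x - p i))

/-- The empirical measure `μ_N = (1/N) ∑_{n < N} δ_{S_n(ω)}` (used for `N ≥ 1`). -/
noncomputable def empiricalMeasure {Ω 𝒳 : Type*} [MeasurableSpace 𝒳] (S : ℕ → Ω → 𝒳) (N : ℕ)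
    (ω : Ω) : Measure 𝒳 :=
  (N : ENNReal)⁻¹ • ∑ n ∈ Finset.range N, Measure.dirac (S n ω)

theorem Real.exp_add_exp_le_of_le_max {a b A B : ℝ} (ha : a ≤ max A B) (hb : b ≤ max A B)
    (hab : a + b ≤ A + B) : Real.exp a + Real.exp b ≤ Real.exp A + Real.exp B := by
  wlog h : B ≤ A generalizing A B
  · rw [add_comm (Real.exp A)]
    exact this (by rwa [max_comm]) (by rwa [max_comm]) (by linarith) (by linarith)
  rw [max_eq_left h] at ha hb
  rcases le_total a B with h1 | h1
  · linarith [Real.exp_le_exp.2 h1, Real.exp_le_exp.2 hb]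
  · have h2 : Real.exp b ≤ Real.exp A * Real.exp (B - a) := by
      rw [← Real.exp_add]; exact Real.exp_le_exp.2 (by linarith)
    have h3 : Real.exp B = Real.exp a * Real.exp (B - a) := by
      rw [← Real.exp_add]; congr 1; ring
    have h4 := Real.exp_le_exp.2 ha
    have h5 : Real.exp (B - a) ≤ 1 := Real.exp_le_one_iff.2 (by linarith)
    nlinarith

/-- The comparison step of the contraction principle, for a single Rademacher sign. -/
theorem exp_iSup_add_exp_iSup_le_of_contraction {ι : Type*} [Nonempty ι] {u s f : ι → ℝ} {C : ℝ}
    (hu : ∀ i, |u i| ≤ C) (hs : ∀ i, |s i| ≤ C) (hf : ∀ i, |f i| ≤ |s i|)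
    (hfs : ∀ i j, |f i - f j| ≤ |s i - s j|) :
    Real.exp (⨆ i, (u i + f i)) + Real.exp (⨆ i, (u i - f i))
      ≤ Real.exp (⨆ i, (u i + s i)) + Real.exp (⨆ i, (u i - s i)) := by
  have hA : BddAbove (Set.range fun i => u i + s i) := by
    refine ⟨C + C, ?_⟩
    rintro _ ⟨i, rfl⟩
    exact add_le_add ((le_abs_self _).trans (hu i)) ((le_abs_self _).trans (hs i))
  have hB : BddAbove (Set.range fun i => u i - s i) := by
    refine ⟨C + C, ?_⟩
    rintro _ ⟨i, rfl⟩
    have := neg_abs_le (s i)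
    have := le_abs_self (u i)
    linarith [hu i, hs i]
  have hmax : ∀ i, u i + |s i| ≤ max (⨆ i, (u i + s i)) (⨆ i, (u i - s i)) := by
    intro i
    rcases abs_cases (s i) with ⟨h, -⟩ | ⟨h, -⟩ <;> rw [h]
    · exact le_max_of_le_left (le_ciSup hA i)
    · exact le_max_of_le_right (le_ciSup hB i)
  apply Real.exp_add_exp_le_of_le_max
  · exact ciSup_le fun i => le_trans (by linarith [le_abs_self (f i), hf i]) (hmax i)
  · exact ciSup_le fun i => le_trans (by linarith [neg_abs_le (f i), hf i]) (hmax i)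
  · have key : ∀ i j, (u i + f i) + (u j - f j) ≤ (⨆ i, (u i + s i)) + ⨆ i, (u i - s i) := by
      intro i j
      have h1 := (le_abs_self _).trans (hfs i j)
      have hAi := le_ciSup hA i
      have hAj := le_ciSup hA j
      have hBi := le_ciSup hB i
      have hBj := le_ciSup hB j
      rcases abs_cases (s i - s j) with ⟨h, -⟩ | ⟨h, -⟩ <;> rw [h] at h1 <;> linarith
    rw [← le_sub_iff_add_le]
    refine ciSup_le fun i => ?_
    rw [le_sub_comm]
    exact ciSup_le fun j => by linarith [key i j]

theorem Real.cosh_add_cosh_le_of_sq_add_sq_eq {p q r s : ℝ} (h : r ^ 2 + s ^ 2 = p ^ 2 + q ^ 2)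
    (hr : r ^ 2 ≤ p ^ 2) (hs : s ^ 2 ≤ p ^ 2) :
    Real.cosh r + Real.cosh s ≤ Real.cosh p + Real.cosh q := by
  have hpow : ∀ n : ℕ, (r ^ 2) ^ n + (s ^ 2) ^ n ≤ (p ^ 2) ^ n + (q ^ 2) ^ n := by
    intro n
    have hq : q ^ 2 ≤ r ^ 2 := by linarith
    rcases eq_or_lt_of_le (hq.trans hr) with e | e
    · have : r ^ 2 = p ^ 2 := by linarith
      have : s ^ 2 = q ^ 2 := by linarith
      simp [*]
    · set α := (r ^ 2 - q ^ 2) / (p ^ 2 - q ^ 2) with hα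
      have hd : 0 < p ^ 2 - q ^ 2 := by linarith
      have hα0 : 0 ≤ α := div_nonneg (by linarith) hd.le
      have hα1 : 0 ≤ 1 - α := by
        rw [sub_nonneg, hα, div_le_one hd]; linarith
      have hαm : α * (p ^ 2 - q ^ 2) = r ^ 2 - q ^ 2 := by rw [hα]; field_simp
      have c := convexOn_pow (𝕜 := ℝ) n
      have c1 := c.2 (Set.mem_Ici.2 (sq_nonneg p)) (Set.mem_Ici.2 (sq_nonneg q)) hα0 hα1 (by ring)
      have c2 := c.2 (Set.mem_Ici.2 (sq_nonneg p)) (Set.mem_Ici.2 (sq_nonneg q)) hα1 hα0 (by ring)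
      simp only [smul_eq_mul] at c1 c2
      rw [show α * p ^ 2 + (1 - α) * q ^ 2 = r ^ 2 by linarith] at c1
      rw [show (1 - α) * p ^ 2 + α * q ^ 2 = s ^ 2 by linarith] at c2
      linarith
  refine hasSum_le (fun n => ?_) ((Real.hasSum_cosh r).add (Real.hasSum_cosh s))
    ((Real.hasSum_cosh p).add (Real.hasSum_cosh q))
  rw [← add_div, ← add_div]
  simp only [pow_mul]
  exact div_le_div_of_nonneg_right (hpow n) (by positivity)

theorem cosh_norm_add_add_cosh_norm_sub_le {E : Type*} [NormedAddCommGroup E]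
    [InnerProductSpace ℝ E] (x v : E) :
    Real.cosh ‖x + v‖ + Real.cosh ‖x - v‖ ≤ 2 * (Real.cosh ‖x‖ * Real.exp (‖v‖ ^ 2 / 2)) := by
  have h : Real.cosh ‖x + v‖ + Real.cosh ‖x - v‖
      ≤ Real.cosh (‖x‖ + ‖v‖) + Real.cosh (‖x‖ - ‖v‖) := by
    apply Real.cosh_add_cosh_le_of_sq_add_sq_eq
    · have := parallelogram_law_with_norm ℝ x v
      nlinarith
    · exact pow_le_pow_left₀ (norm_nonneg _) (norm_add_le _ _) 2
    · exact pow_le_pow_left₀ (norm_nonneg _) (norm_sub_le _ _) 2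
  rw [Real.cosh_add, Real.cosh_sub] at h
  have := mul_le_mul_of_nonneg_left (Real.cosh_le_exp_half_sq ‖v‖) (Real.cosh_pos ‖x‖).le
  linarith

/-- Symmetrization in one variable, at the level of exponential moments. -/
theorem lintegral_exp_iSup_sub_le {𝒳 : Type*} [MeasurableSpace 𝒳] {μ : Measure 𝒳}
    [IsProbabilityMeasure μ] {u : ℕ → ℝ} {f : ℕ → 𝒳 → ℝ} {C : ℝ} (hu : ∀ i, |u i| ≤ C)
    (hfm : ∀ i, Measurable (f i)) (hf : ∀ i x, |f i x| ≤ C) :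
    ∫⁻ x, ENNReal.ofReal (Real.exp (⨆ i, (u i + (∫ z, f i z ∂μ - f i x)))) ∂μ
      ≤ ∫⁻ x, ENNReal.ofReal ((Real.exp (⨆ i, (u i + 2 * f i x))
          + Real.exp (⨆ i, (u i - 2 * f i x))) / 2) ∂μ := by
  set a : 𝒳 → ℝ := fun x => ⨆ i, (u i + 2 * f i x) with ha
  set b : 𝒳 → ℝ := fun x => ⨆ i, (u i - 2 * f i x) with hb
  have ham : Measurable a := .iSup fun i => ((hfm i).const_mul 2).const_add _
  have hbm : Measurable b := .iSup fun i => ((hfm i).const_mul 2).const_sub _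
  have hau : ∀ i x, u i + 2 * f i x ≤ 3 * C := fun i x => by
    linarith [le_abs_self (u i), hu i, le_abs_self (f i x), hf i x]
  have hbu : ∀ i x, u i - 2 * f i x ≤ 3 * C := fun i x => by
    linarith [le_abs_self (u i), hu i, neg_abs_le (f i x), hf i x]
  have hai : ∀ i x, u i + 2 * f i x ≤ a x := fun i x =>
    le_ciSup (f := fun i => u i + 2 * f i x) ⟨3 * C, by rintro _ ⟨j, rfl⟩; exact hau j x⟩ i
  have hbi : ∀ i x, u i - 2 * f i x ≤ b x := fun i x =>
    le_ciSup (f := fun i => u i - 2 * f i x) ⟨3 * C, by rintro _ ⟨j, rfl⟩; exact hbu j x⟩ i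
  have hab : ∀ x, ‖a x‖ ≤ 3 * C := fun x => by
    rw [Real.norm_eq_abs, abs_le]
    refine ⟨?_, ciSup_le fun i => hau i x⟩
    have := hai 0 x
    linarith [neg_abs_le (u 0), hu 0, neg_abs_le (f 0 x), hf 0 x]
  have hbb : ∀ x, b x ≤ 3 * C := fun x => ciSup_le fun i => hbu i x
  have haint : Integrable a μ := .of_bound ham.aestronglyMeasurable (3 * C) (.of_forall hab)
  have hfint : ∀ i, Integrable (f i) μ := fun i =>
    .of_bound (hfm i).aestronglyMeasurable C (.of_forall (hf i))
  have hexp : ∀ {g : 𝒳 → ℝ}, Measurable g → (∀ x, g x ≤ 3 * C) →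
      Integrable (fun x => Real.exp (g x)) μ := fun {g} hg h =>
    .of_bound hg.exp.aestronglyMeasurable (Real.exp (3 * C)) (.of_forall fun x => by
      rw [Real.norm_eq_abs, Real.abs_exp]; exact Real.exp_le_exp.2 (h x))
  have hea := hexp ham fun x => (le_abs_self _).trans (hab x)
  have heb := hexp hbm hbb
  have hjensen : Real.exp (∫ x, a x ∂μ) ≤ ∫ x, Real.exp (a x) ∂μ :=
    convexOn_exp.map_integral_le Real.continuous_exp.continuousOn isClosed_univ
      (.of_forall fun _ => Set.mem_univ _) haint hea
  have hpt : ∀ x, Real.exp (⨆ i, (u i + (∫ z, f i z ∂μ - f i x)))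
      ≤ (∫ z, Real.exp (a z) ∂μ + Real.exp (b x)) / 2 := by
    intro x
    have h1 : ⨆ i, (u i + (∫ z, f i z ∂μ - f i x)) ≤ (∫ z, a z ∂μ + b x) / 2 := by
      refine ciSup_le fun i => ?_
      have h2 : u i + 2 * ∫ z, f i z ∂μ ≤ ∫ z, a z ∂μ := by
        have hint : Integrable (fun z => u i + 2 * f i z) μ :=
          (integrable_const (u i)).add ((hfint i).const_mul 2)
        have := integral_mono hint haint (hai i)
        rwa [integral_add (integrable_const _) ((hfint i).const_mul 2), integral_const_mul,
          integral_const, probReal_univ, one_smul] at this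
      linarith [hbi i x]
    have h3 := convexOn_exp.2 (Set.mem_univ (∫ z, a z ∂μ)) (Set.mem_univ (b x))
      (by norm_num : (0 : ℝ) ≤ 1 / 2) (by norm_num : (0 : ℝ) ≤ 1 / 2) (by norm_num)
    simp only [smul_eq_mul] at h3
    calc _ ≤ Real.exp ((∫ z, a z ∂μ + b x) / 2) := Real.exp_le_exp.2 h1
      _ = Real.exp (1 / 2 * ∫ z, a z ∂μ + 1 / 2 * b x) := by congr 1; ring
      _ ≤ _ := by linarith
  calc _ ≤ ∫⁻ x, ENNReal.ofReal ((∫ z, Real.exp (a z) ∂μ + Real.exp (b x)) / 2) ∂μ :=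
        lintegral_mono fun x => ENNReal.ofReal_le_ofReal (hpt x)
    _ = ENNReal.ofReal (∫ x, (∫ z, Real.exp (a z) ∂μ + Real.exp (b x)) / 2 ∂μ) :=
        (ofReal_integral_eq_lintegral_ofReal (((integrable_const _).add heb).div_const 2) (.of_forall fun x =>
          div_nonneg (add_nonneg (integral_nonneg fun _ => (Real.exp_pos _).le)
            (Real.exp_pos _).le) zero_le_two)).symm
    _ = ENNReal.ofReal (∫ x, (Real.exp (a x) + Real.exp (b x)) / 2 ∂μ) := by
        rw [integral_div, integral_div, integral_add (integrable_const _) heb,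
          integral_add hea heb, integral_const, probReal_univ, one_smul]
    _ = _ := ofReal_integral_eq_lintegral_ofReal ((hea.add heb).div_const 2)
        (.of_forall fun x => by positivity)

/-- A dimension-free exponential moment bound for empirical processes dominated by a bounded
linear process on an inner product space. -/
theorem lintegral_pi_exp_iSup_le {𝒳 E : Type*} [MeasurableSpace 𝒳] [NormedAddCommGroup E]
    [InnerProductSpace ℝ E] (μ : Measure 𝒳) [IsProbabilityMeasure μ] {V : 𝒳 → E}
    (hVm : ∀ y : E, Measurable fun x => inner ℝ y (V x)) {K B : ℝ} (hB : 0 ≤ B)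
    (hV : ∀ x, ‖V x‖ ≤ K) {t : ℕ → E} (ht : ∀ i, ‖t i‖ ≤ B) {f : ℕ → 𝒳 → ℝ}
    (hfm : ∀ i, Measurable (f i)) (hf : ∀ i x, |f i x| ≤ |inner ℝ (t i) (V x)|)
    (hfs : ∀ i j x, |f i x - f j x| ≤ |inner ℝ (t i) (V x) - inner ℝ (t j) (V x)|) (N : ℕ) (y : E) :
    ∫⁻ x : Fin N → 𝒳, ENNReal.ofReal (Real.exp (⨆ i, (inner ℝ (t i) y
        + ∑ n, (∫ z, f i z ∂μ - f i (x n))))) ∂(Measure.pi fun _ => μ)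
      ≤ ENNReal.ofReal (2 * Real.cosh ‖B • y‖ * Real.exp (2 * (B * K) ^ 2) ^ N) := by
  have hin : ∀ i y, |inner ℝ (t i) y| ≤ B * ‖y‖ := fun i y =>
    (abs_real_inner_le_norm _ _).trans (mul_le_mul_of_nonneg_right (ht i) (norm_nonneg _))
  have hfb : ∀ i x, |f i x| ≤ B * K := fun i x =>
    ((hf i x).trans (hin i _)).trans (mul_le_mul_of_nonneg_left (hV x) hB)
  have hEb : ∀ i, |∫ z, f i z ∂μ| ≤ B * K := fun i => by
    have := norm_integral_le_of_norm_le_const (μ := μ) (f := f i) (C := B * K) (.of_forall (hfb i))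
    simpa using this
  induction N generalizing y with
  | zero =>
    simp only [Finset.univ_eq_empty, Finset.sum_empty, add_zero, pow_zero, mul_one]
    simp only [lintegral_const, measure_univ, mul_one]
    refine ENNReal.ofReal_le_ofReal ?_
    have h1 : ⨆ i, inner ℝ (t i) y ≤ ‖B • y‖ := ciSup_le fun i => by
      rw [norm_smul, Real.norm_of_nonneg hB]
      exact (le_abs_self _).trans (hin i y)
    calc _ ≤ Real.exp ‖B • y‖ := Real.exp_le_exp.2 h1
      _ ≤ _ := by rw [Real.cosh_eq]; linarith [Real.exp_pos (-‖B • y‖)]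
  | succ N ih =>
    set F : E → (Fin N → 𝒳) → ℝ := fun y x => Real.exp (⨆ i, (inner ℝ (t i) y
        + ∑ n, (∫ z, f i z ∂μ - f i (x n)))) with hF
    have hΦ : Measurable fun q : 𝒳 × (Fin N → 𝒳) => ENNReal.ofReal (Real.exp (⨆ i,
        (inner ℝ (t i) y + ((∫ z, f i z ∂μ - f i q.1) + ∑ n, (∫ z, f i z ∂μ - f i (q.2 n)))))) := by
      refine ENNReal.measurable_ofReal.comp (Real.measurable_exp.comp (.iSup fun i => ?_))
      have := hfm i
      fun_prop
    have hΨ : ∀ s : ℝ, Measurable fun q : 𝒳 × (Fin N → 𝒳) => F (y + s • V q.1) q.2 := by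
      intro s
      refine Real.measurable_exp.comp (.iSup fun i => ?_)
      have := hfm i
      have : Measurable fun q : 𝒳 × (Fin N → 𝒳) => inner ℝ (t i) (V q.1) :=
        (hVm (t i)).comp measurable_fst
      simp only [inner_add_right, inner_smul_right]
      fun_prop
    have hstep : ∀ z : Fin N → 𝒳, ∫⁻ x, ENNReal.ofReal (Real.exp (⨆ i, (inner ℝ (t i) y
        + ((∫ z, f i z ∂μ - f i x) + ∑ n, (∫ z, f i z ∂μ - f i (z n)))))) ∂μ
        ≤ ∫⁻ x, ENNReal.ofReal ((F (y + (2 : ℝ) • V x) z + F (y + (-2 : ℝ) • V x) z) / 2) ∂μ := by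
      intro z
      set u : ℕ → ℝ := fun i => inner ℝ (t i) y + ∑ n, (∫ z, f i z ∂μ - f i (z n)) with hu
      set C : ℝ := B * ‖y‖ + N * (2 * (B * K)) + 2 * (B * K) with hC
      have hBK : ∀ x : 𝒳, 0 ≤ B * K := fun x => (abs_nonneg _).trans (hfb 0 x)
      obtain ⟨x₀⟩ : Nonempty 𝒳 := nonempty_of_isProbabilityMeasure μ
      have hBK := hBK x₀
      have huC : ∀ i, |u i| ≤ B * ‖y‖ + N * (2 * (B * K)) := by
        intro i
        refine (abs_add_le _ _).trans (add_le_add (hin i y) ?_)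
        refine (Finset.abs_sum_le_sum_abs _ _).trans ?_
        calc _ ≤ ∑ _n : Fin N, 2 * (B * K) := Finset.sum_le_sum fun n _ =>
              (abs_sub _ _).trans (by linarith [hEb i, hfb i (z n)])
          _ = _ := by simp
      have hNBK : 0 ≤ (N : ℝ) * (2 * (B * K)) := by positivity
      have hBy : 0 ≤ B * ‖y‖ := by positivity
      have h1 := lintegral_exp_iSup_sub_le (μ := μ) (u := u) (f := f) (C := C)
        (fun i => (huC i).trans (by linarith)) hfm (fun i x => (hfb i x).trans (by linarith))
      have h2 : ∀ x, Real.exp (⨆ i, (u i + 2 * f i x)) + Real.exp (⨆ i, (u i - 2 * f i x))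
          ≤ F (y + (2 : ℝ) • V x) z + F (y + (-2 : ℝ) • V x) z := by
        intro x
        have h3 := exp_iSup_add_exp_iSup_le_of_contraction (u := u) (f := fun i => 2 * f i x)
          (s := fun i => 2 * inner ℝ (t i) (V x)) (C := C) (fun i => (huC i).trans (by linarith))
          (fun i => by
            rw [abs_mul, abs_two]
            linarith [(hin i (V x)).trans (mul_le_mul_of_nonneg_left (hV x) hB)])
          (fun i => by
            rw [abs_mul, abs_mul]; exact mul_le_mul_of_nonneg_left (hf i x) (abs_nonneg _))
          (fun i j => by
            rw [← mul_sub, ← mul_sub, abs_mul, abs_mul]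
            exact mul_le_mul_of_nonneg_left (hfs i j x) (abs_nonneg _))
        refine h3.trans (le_of_eq ?_)
        simp only [hF, hu, inner_add_right, inner_smul_right]
        congr 3 <;> (ext i; ring)
      refine le_trans (le_of_eq ?_) (h1.trans (lintegral_mono fun x =>
        ENNReal.ofReal_le_ofReal (div_le_div_of_nonneg_right (h2 x) zero_le_two)))
      refine lintegral_congr fun x => ?_
      congr 3
      ext i
      simp only [hu]
      ring
    have hmp := measurePreserving_piFinSuccAbove (fun _ : Fin (N + 1) => μ) 0
    have hpi : ∫⁻ x : Fin (N + 1) → 𝒳, ENNReal.ofReal (Real.exp (⨆ i, (inner ℝ (t i) y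
        + ∑ n, (∫ z, f i z ∂μ - f i (x n))))) ∂(Measure.pi fun _ => μ)
        = ∫⁻ q : 𝒳 × (Fin N → 𝒳), ENNReal.ofReal (Real.exp (⨆ i, (inner ℝ (t i) y
          + ((∫ z, f i z ∂μ - f i q.1) + ∑ n, (∫ z, f i z ∂μ - f i (q.2 n))))))
            ∂(μ.prod (Measure.pi fun _ => μ)) := by
      rw [← hmp.lintegral_comp_emb (MeasurableEquiv.measurableEmbedding _)]
      refine lintegral_congr fun x => ?_
      congr 3
      ext i
      rw [Fin.sum_univ_succ]
      rfl
    have hsm : Measurable fun q : 𝒳 × (Fin N → 𝒳) =>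
        ENNReal.ofReal ((F (y + (2 : ℝ) • V q.1) q.2 + F (y + (-2 : ℝ) • V q.1) q.2) / 2) :=
      (((hΨ 2).add (hΨ (-2))).div_const 2).ennreal_ofReal
    set e := Real.exp (2 * (B * K) ^ 2) with he
    have hinner : ∀ x, ∫⁻ z : Fin N → 𝒳,
        ENNReal.ofReal ((F (y + (2 : ℝ) • V x) z + F (y + (-2 : ℝ) • V x) z) / 2)
          ∂(Measure.pi fun _ => μ) ≤ ENNReal.ofReal (2 * Real.cosh ‖B • y‖ * e ^ (N + 1)) := by
      intro x
      have hsplit : ∀ z, ENNReal.ofReal ((F (y + (2 : ℝ) • V x) z + F (y + (-2 : ℝ) • V x) z) / 2)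
          = ENNReal.ofReal (1 / 2) * (ENNReal.ofReal (F (y + (2 : ℝ) • V x) z)
            + ENNReal.ofReal (F (y + (-2 : ℝ) • V x) z)) := by
        intro z
        rw [← ENNReal.ofReal_add (Real.exp_pos _).le (Real.exp_pos _).le,
          ← ENNReal.ofReal_mul (by norm_num)]
        congr 1; ring
      simp only [hsplit]
      have hm2 : Measurable fun z => ENNReal.ofReal (F (y + (2 : ℝ) • V x) z) :=
        ((hΨ 2).comp measurable_prodMk_left).ennreal_ofReal
      rw [lintegral_const_mul' _ _ ENNReal.ofReal_ne_top, lintegral_add_left hm2]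
      refine (mul_le_mul_right (add_le_add (ih _) (ih _)) _).trans ?_
      rw [← ENNReal.ofReal_add (by positivity) (by positivity), ← ENNReal.ofReal_mul (by norm_num)]
      refine ENNReal.ofReal_le_ofReal ?_
      have hc := cosh_norm_add_add_cosh_norm_sub_le (B • y) (B • (2 : ℝ) • V x)
      have hle : Real.exp (‖B • (2 : ℝ) • V x‖ ^ 2 / 2) ≤ e := by
        rw [he]
        refine Real.exp_le_exp.2 ?_
        rw [norm_smul, norm_smul, Real.norm_of_nonneg hB, Real.norm_two]
        have := mul_le_mul_of_nonneg_left (hV x) hB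
        have := pow_le_pow_left₀ (by positivity) this 2
        nlinarith
      have e1 : B • (y + (2 : ℝ) • V x) = B • y + B • (2 : ℝ) • V x := smul_add _ _ _
      have e2 : B • (y + (-2 : ℝ) • V x) = B • y - B • (2 : ℝ) • V x := by
        rw [neg_smul, ← sub_eq_add_neg, smul_sub]
      rw [e1, e2, pow_succ]
      have hcp := Real.cosh_pos ‖B • y‖
      have hmul := mul_le_mul_of_nonneg_left hle hcp.le
      have hN : 0 ≤ e ^ N := by positivity
      calc _ = (Real.cosh ‖B • y + B • (2 : ℝ) • V x‖ + Real.cosh ‖B • y - B • (2 : ℝ) • V x‖)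
              * e ^ N := by ring
        _ ≤ (2 * (Real.cosh ‖B • y‖ * e)) * e ^ N :=
          mul_le_mul_of_nonneg_right (by linarith) hN
        _ = _ := by ring
    calc _ = _ := hpi
      _ = ∫⁻ z : Fin N → 𝒳, ∫⁻ x, _ ∂μ ∂(Measure.pi fun _ => μ) :=
          lintegral_prod_symm _ hΦ.aemeasurable
      _ ≤ ∫⁻ z : Fin N → 𝒳, ∫⁻ x, _ ∂μ ∂(Measure.pi fun _ => μ) := lintegral_mono hstep
      _ = ∫⁻ x, ∫⁻ z : Fin N → 𝒳, _ ∂(Measure.pi fun _ => μ) ∂μ :=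
          (lintegral_prod_symm _ hsm.aemeasurable).symm.trans (lintegral_prod _ hsm.aemeasurable)
      _ ≤ ∫⁻ _x, ENNReal.ofReal (2 * Real.cosh ‖B • y‖ * e ^ (N + 1)) ∂μ := lintegral_mono hinner
      _ = _ := by simp

theorem ConvexOn.sub_mul_sub_le {l : ℝ → ℝ} (hl : ConvexOn ℝ Set.univ l) {x y a b : ℝ}
    (hxy : x ≤ y) (hab : a < b) (hxa : x ≤ a) (hyb : y ≤ b) :
    (l y - l x) * (b - a) ≤ (l b - l a) * (y - x) := by
  rcases hxy.eq_or_lt with rfl | hxy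
  · simp
  have h1 := hl.secant_mono (Set.mem_univ x) (Set.mem_univ y) (Set.mem_univ b) hxy.ne'
    (hxy.trans_le hyb).ne' hyb
  have h2 := hl.secant_mono (Set.mem_univ b) (Set.mem_univ x) (Set.mem_univ a)
    (hxy.trans_le hyb).ne hab.ne hxa
  rw [← neg_sub (l b), ← neg_sub b, neg_div_neg_eq, ← neg_sub (l b), ← neg_sub b,
    neg_div_neg_eq] at h2
  exact (div_le_div_iff₀ (sub_pos.2 hxy) (sub_pos.2 hab)).1 (h1.trans h2)

namespace IsLossFunction

variable {l : ℝ → ℝ}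

theorem add_le (hl : IsLossFunction l) (x : ℝ) : l 0 + x ≤ l x := by
  simpa using hl.one_mem_subdifferential x

theorem abs_sub_le (hl : IsLossFunction l) {A x y : ℝ} (hx : x ≤ A) (hy : y ≤ A) :
    |l x - l y| ≤ (l (A + 1) - l A) * |x - y| := by
  wlog h : y ≤ x generalizing x y
  · rw [abs_sub_comm, abs_sub_comm x]
    exact this hy hx (le_of_not_ge h)
  rw [abs_of_nonneg (sub_nonneg.2 (hl.mono h)), abs_of_nonneg (sub_nonneg.2 h)]
  simpa using hl.convex.sub_mul_sub_le h (lt_add_one A) hy (hx.trans (lt_add_one A).le)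

theorem le_sub (hl : IsLossFunction l) {A x y : ℝ} (hx : A ≤ x) (hxy : x ≤ y) :
    (l A - l (A - 1)) * (y - x) ≤ l y - l x := by
  rcases hxy.eq_or_lt with rfl | hxy
  · simp
  simpa using hl.convex.sub_mul_sub_le (sub_one_lt A).le hxy ((sub_one_lt A).le.trans hx)
    (hx.trans hxy.le)

theorem sub_le_sub_of_nonpos (hl : IsLossFunction l) {x y : ℝ} (hxy : x ≤ y) (hy : y ≤ 0) :
    l y - l x ≤ y - x := by
  rcases (hxy.trans hy).eq_or_lt with rfl | hx
  · simp [le_antisymm hy hxy]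
  have h := hl.convex.sub_mul_sub_le hxy hx le_rfl hy
  have := hl.add_le x
  nlinarith

theorem sub_le_sub_of_nonneg (hl : IsLossFunction l) {x y : ℝ} (hx : 0 ≤ x) (hxy : x ≤ y) :
    y - x ≤ l y - l x := by
  rcases hxy.eq_or_lt with rfl | hxy
  · simp
  have h := hl.convex.sub_mul_sub_le (hx.trans hxy.le) hxy hx le_rfl
  have := hl.add_le y
  nlinarith

variable {𝒳 : Type*} [MeasurableSpace 𝒳] {μ ν : Measure 𝒳} [IsProbabilityMeasure μ]
  [IsProbabilityMeasure ν] {H : 𝒳 → ℝ} {D : ℝ}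

theorem integrable (hl : IsLossFunction l) (hH : Measurable H) (hD : ∀ x, |H x| ≤ D) (m : ℝ) :
    Integrable (fun x => l (H x - m)) μ :=
  .of_bound (hl.mono.measurable.comp (hH.sub_const m)).aestronglyMeasurable (l (D - m))
    (.of_forall fun x => by
      rw [Real.norm_of_nonneg (hl.nonneg _)]
      exact hl.mono (by linarith [le_abs_self (H x), hD x]))

theorem integral_add_const (hl : IsLossFunction l) (hH : Measurable H) (hD : ∀ x, |H x| ≤ D)
    (m c : ℝ) : ∫ x, (l (H x - m) + c) ∂μ = ∫ x, l (H x - m) ∂μ + c := by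
  rw [integral_add (hl.integrable hH hD m) (integrable_const _), integral_const, probReal_univ,
    one_smul]

theorem neg_le_oce_objective (hl : IsLossFunction l) (hH : Measurable H) (hD : ∀ x, |H x| ≤ D)
    (m : ℝ) : -D ≤ ∫ x, l (H x - m) ∂μ + m := by
  have h : ∫ _x, (-D : ℝ) ∂μ ≤ ∫ x, (l (H x - m) + m) ∂μ := by
    refine integral_mono (integrable_const _)
      ((hl.integrable hH hD m).add (integrable_const _)) fun x => ?_
    have := hl.add_le (H x - m)
    simp only
    linarith [neg_abs_le (H x), hD x, hl.nonneg 0]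
  rwa [hl.integral_add_const hH hD, integral_const, probReal_univ, one_smul] at h

theorem bddBelow_oce_objective (hl : IsLossFunction l) (hH : Measurable H)
    (hD : ∀ x, |H x| ≤ D) : BddBelow (Set.range fun m : ℝ => ∫ x, l (H x - m) ∂μ + m) := by
  refine ⟨-D, ?_⟩
  rintro _ ⟨m, rfl⟩
  exact hl.neg_le_oce_objective hH hD m

theorem exists_oce_objective_le (hl : IsLossFunction l) (hH : Measurable H)
    (hD : ∀ x, |H x| ≤ D) (hD0 : 0 ≤ D) (m : ℝ) : ∃ m' : ℝ, |m'| ≤ D ∧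
      ∫ x, l (H x - m') ∂μ + m' ≤ ∫ x, l (H x - m) ∂μ + m := by
  have hmono : ∀ m', (∀ x, l (H x - m') + m' ≤ l (H x - m) + m) →
      ∫ x, l (H x - m') ∂μ + m' ≤ ∫ x, l (H x - m) ∂μ + m := fun m' h => by
    rw [← hl.integral_add_const hH hD, ← hl.integral_add_const hH hD]
    exact integral_mono ((hl.integrable hH hD m').add (integrable_const _))
      ((hl.integrable hH hD m).add (integrable_const _)) h
  by_cases h1 : D ≤ m
  · refine ⟨D, (abs_of_nonneg hD0).le, hmono D fun x => ?_⟩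
    have := hl.sub_le_sub_of_nonpos (x := H x - m) (y := H x - D) (by linarith)
      (by linarith [le_abs_self (H x), hD x])
    linarith
  by_cases h2 : m ≤ -D
  · refine ⟨-D, by rw [abs_neg, abs_of_nonneg hD0], hmono (-D) fun x => ?_⟩
    have := hl.sub_le_sub_of_nonneg (x := H x - -D) (y := H x - m)
      (by linarith [neg_abs_le (H x), hD x]) (by linarith)
    linarith
  · exact ⟨m, abs_le.2 ⟨by linarith, by linarith⟩, le_rfl⟩

theorem optimizedCertaintyEquivalent_le_add (hl : IsLossFunction l) (hH : Measurable H)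
    (hD : ∀ x, |H x| ≤ D) (hD0 : 0 ≤ D) {δ : ℝ}
    (hδ : ∀ m, |m| ≤ D → |∫ x, l (H x - m) ∂μ - ∫ x, l (H x - m) ∂ν| ≤ δ) :
    optimizedCertaintyEquivalent l ν H ≤ optimizedCertaintyEquivalent l μ H + δ := by
  rw [← sub_le_iff_le_add]
  refine le_ciInf fun m => ?_
  obtain ⟨m', hm', hle⟩ := hl.exists_oce_objective_le (μ := μ) hH hD hD0 m
  have h1 : optimizedCertaintyEquivalent l ν H ≤ ∫ x, l (H x - m') ∂ν + m' :=
    ciInf_le (hl.bddBelow_oce_objective hH hD) m'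
  linarith [neg_abs_le (∫ x, l (H x - m') ∂μ - ∫ x, l (H x - m') ∂ν), hδ m' hm']

theorem optimizedCertaintyEquivalent_add_const (hl : IsLossFunction l) (hH : Measurable H)
    (hD : ∀ x, |H x| ≤ D) (c : ℝ) : optimizedCertaintyEquivalent l μ (fun x => H x + c)
      = optimizedCertaintyEquivalent l μ H + c := by
  unfold optimizedCertaintyEquivalent
  rw [ciInf_add (hl.bddBelow_oce_objective hH hD)]
  refine Equiv.iInf_congr (Equiv.subRight c) fun m => ?_
  simp only [Equiv.subRight_apply]
  rw [add_assoc, sub_add_cancel]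
  simp only [sub_sub_eq_add_sub]

theorem integral_le_one_of_sub_le (hl : IsLossFunction l) (hH : Measurable H)
    (hD : ∀ x, |H x| ≤ D) {x₀ : ℝ} (hx₀ : l x₀ ≤ 1) {m : ℝ} (hm : D - x₀ ≤ m) :
    ∫ x, l (H x - m) ∂μ ≤ 1 := by
  have h : ∫ x, l (H x - m) ∂μ ≤ ∫ _x, (1 : ℝ) ∂μ :=
    integral_mono (hl.integrable hH hD m) (integrable_const _) fun x =>
      (hl.mono (by linarith [le_abs_self (H x), hD x])).trans hx₀
  simpa using h

theorem le_of_integral_le_one (hl : IsLossFunction l) (hH : Measurable H)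
    (hD : ∀ x, |H x| ≤ D) {m : ℝ} (hm : ∫ x, l (H x - m) ∂μ ≤ 1) : -D - 2 ≤ m := by
  by_contra! hlt
  have h : ∫ _x, (2 : ℝ) ∂μ ≤ ∫ x, l (H x - m) ∂μ :=
    integral_mono (integrable_const _) (hl.integrable hH hD m) fun x => by
      have := hl.add_le (H x - m)
      simp only
      linarith [neg_abs_le (H x), hD x, hl.nonneg 0]
  rw [integral_const, probReal_univ, one_smul] at h
  linarith

theorem bddBelow_shortfall (hl : IsLossFunction l) (hH : Measurable H) (hD : ∀ x, |H x| ≤ D) :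
    BddBelow {m : ℝ | ∫ x, l (H x - m) ∂μ ≤ 1} :=
  ⟨-D - 2, fun _ hm => hl.le_of_integral_le_one hH hD hm⟩

theorem shortfallRisk_le_add (hl : IsLossFunction l) (hlm : StrictMono l) (hH : Measurable H)
    (hD : ∀ x, |H x| ≤ D) (hD0 : 0 ≤ D) {x₀ : ℝ} (hx₀ : l x₀ ≤ 1) {δ : ℝ}
    (hδ : ∀ m, |m| ≤ D + 2 + |x₀| → |∫ x, l (H x - m) ∂μ - ∫ x, l (H x - m) ∂ν| ≤ δ) :
    shortfallRisk l ν H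
      ≤ shortfallRisk l μ H + (l (x₀ - 2 * D) - l (x₀ - 2 * D - 1))⁻¹ * δ := by
  set a := l (x₀ - 2 * D) - l (x₀ - 2 * D - 1) with ha
  have ha0 : 0 < a := sub_pos.2 (hlm (sub_one_lt _))
  have hδ0 : 0 ≤ δ := (abs_nonneg _).trans (hδ 0 (by rw [abs_zero]; positivity))
  have hη : 0 ≤ a⁻¹ * δ := by positivity
  rw [← sub_le_iff_le_add]
  refine le_csInf ⟨D - x₀, hl.integral_le_one_of_sub_le hH hD hx₀ le_rfl⟩ fun m hm => ?_
  rw [sub_le_iff_le_add]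
  have hlow := hl.le_of_integral_le_one hH hD hm
  by_cases h1 : D - x₀ ≤ m + a⁻¹ * δ
  · exact csInf_le (hl.bddBelow_shortfall hH hD)
      (hl.integral_le_one_of_sub_le (μ := ν) hH hD hx₀ h1)
  · push Not at h1
    refine csInf_le (hl.bddBelow_shortfall hH hD) ?_
    have hint : ∫ x, (l (H x - (m + a⁻¹ * δ)) + δ) ∂ν ≤ ∫ x, l (H x - m) ∂ν := by
      refine integral_mono ((hl.integrable hH hD _).add (integrable_const _))
        (hl.integrable hH hD m) fun x => ?_
      have h2 := hl.le_sub (A := x₀ - 2 * D) (x := H x - (m + a⁻¹ * δ)) (y := H x - m)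
        (by linarith [neg_abs_le (H x), hD x]) (by linarith)
      rw [← ha, sub_sub_sub_cancel_left, add_sub_cancel_left, mul_inv_cancel_left₀ ha0.ne'] at h2
      simp only
      linarith
    rw [hl.integral_add_const hH hD] at hint
    have h3 := hδ m (abs_le.2 ⟨by linarith [abs_nonneg x₀], by linarith [neg_abs_le x₀]⟩)
    have h4 := neg_abs_le (∫ x, l (H x - m) ∂μ - ∫ x, l (H x - m) ∂ν)
    have h5 : ∫ x, l (H x - m) ∂μ ≤ 1 := hm
    show ∫ x, l (H x - (m + a⁻¹ * δ)) ∂ν ≤ 1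
    linarith

theorem shortfallRisk_add_const (hl : IsLossFunction l) (hH : Measurable H)
    (hD : ∀ x, |H x| ≤ D) {x₀ : ℝ} (hx₀ : l x₀ ≤ 1) (c : ℝ) :
    shortfallRisk l μ (fun x => H x + c) = shortfallRisk l μ H + c := by
  have h := (OrderIso.addRight c).map_csInf
    (⟨D - x₀, hl.integral_le_one_of_sub_le (μ := μ) hH hD hx₀ le_rfl⟩ :
      {m : ℝ | ∫ x, l (H x - m) ∂μ ≤ 1}.Nonempty) (hl.bddBelow_shortfall hH hD)
  rw [OrderIso.addRight_apply] at h
  unfold shortfallRisk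
  rw [h, ← sInf_image']
  congr 1
  ext m
  simp only [Set.mem_ofPred_eq, Set.mem_image, OrderIso.addRight_apply]
  constructor
  · intro hm
    exact ⟨m - c, by simpa only [sub_sub_eq_add_sub] using hm, sub_add_cancel m c⟩
  · rintro ⟨m, hm, rfl⟩
    simpa only [add_sub_add_right_eq_sub] using hm

end IsLossFunction

theorem exists_riskMeasure_stability (k : RiskKind) {l : ℝ → ℝ} (hl : IsLossFunction l)
    (hsf : k = RiskKind.sf → StrictMono l ∧ ∃ x, l x ≤ 1) {D : ℝ} (hD0 : 0 ≤ D) :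
    ∃ M κ : ℝ, 0 ≤ M ∧ 0 < κ ∧ ∀ (𝒳 : Type*) [MeasurableSpace 𝒳] (H : 𝒳 → ℝ), Measurable H →
      (∀ x, |H x| ≤ D) → ∀ (μ : Measure 𝒳) [IsProbabilityMeasure μ] (c : ℝ),
        c - M ≤ riskMeasure k l μ (fun x => H x + c) ∧
        ∀ (ν : Measure 𝒳) [IsProbabilityMeasure ν] (δ : ℝ),
          (∀ m, |m| ≤ M → |∫ x, l (H x - m) ∂μ - ∫ x, l (H x - m) ∂ν| ≤ δ) →
            |riskMeasure k l μ (fun x => H x + c) - riskMeasure k l ν (fun x => H x + c)|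
              ≤ κ * δ := by
  cases k with
  | oce =>
    refine ⟨D, 1, hD0, one_pos, fun 𝒳 _ H hH hD μ _ c => ⟨?_, fun ν _ δ hδ => ?_⟩⟩
    · simp only [riskMeasure]
      rw [hl.optimizedCertaintyEquivalent_add_const hH hD]
      have : -D ≤ optimizedCertaintyEquivalent l μ H :=
        le_ciInf fun m => hl.neg_le_oce_objective hH hD m
      linarith
    · simp only [riskMeasure]
      rw [hl.optimizedCertaintyEquivalent_add_const hH hD,
        hl.optimizedCertaintyEquivalent_add_const hH hD, abs_le]
      have h1 := hl.optimizedCertaintyEquivalent_le_add hH hD hD0 hδ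
      have h2 := hl.optimizedCertaintyEquivalent_le_add (μ := ν) (ν := μ) hH hD hD0
        fun m hm => by rw [abs_sub_comm]; exact hδ m hm
      constructor <;> linarith
  | sf =>
    obtain ⟨hlm, x₀, hx₀⟩ := hsf rfl
    refine ⟨D + 2 + |x₀|, (l (x₀ - 2 * D) - l (x₀ - 2 * D - 1))⁻¹, by positivity,
      inv_pos.2 (sub_pos.2 (hlm (sub_one_lt _))), fun 𝒳 _ H hH hD μ _ c => ⟨?_, fun ν _ δ hδ => ?_⟩⟩
    · simp only [riskMeasure]
      rw [hl.shortfallRisk_add_const hH hD hx₀]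
      have : -D - 2 ≤ shortfallRisk l μ H :=
        le_csInf ⟨D - x₀, hl.integral_le_one_of_sub_le hH hD hx₀ le_rfl⟩
          fun m hm => hl.le_of_integral_le_one hH hD hm
      linarith [abs_nonneg x₀]
    · simp only [riskMeasure]
      rw [hl.shortfallRisk_add_const hH hD hx₀, hl.shortfallRisk_add_const hH hD hx₀, abs_le]
      have h1 := hl.shortfallRisk_le_add hlm hH hD hD0 hx₀ hδ
      have h2 := hl.shortfallRisk_le_add (μ := ν) (ν := μ) hlm hH hD hD0 hx₀
        fun m hm => by rw [abs_sub_comm]; exact hδ m hm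
      constructor <;> linarith

theorem abs_sum_mul_le_of_norm_le {e : ℕ} {g : EuclideanSpace ℝ (Fin e)} {R K : ℝ}
    (hg : ‖g‖ ≤ R) {a : Fin e → ℝ} (ha : ∑ i, |a i| ≤ K) : |∑ i, g i * a i| ≤ R * K :=
  calc |∑ i, g i * a i| ≤ ∑ i, |g i * a i| := Finset.abs_sum_le_sum_abs _ _
    _ ≤ ∑ i, R * |a i| := Finset.sum_le_sum fun i _ => by
        rw [abs_mul]
        exact mul_le_mul_of_nonneg_right ((PiLp.norm_apply_le g i).trans hg) (abs_nonneg _)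
    _ ≤ R * K := by
        rw [← Finset.mul_sum]
        exact mul_le_mul_of_nonneg_left ha ((norm_nonneg g).trans hg)

theorem exists_hedgedRisk_stability (k : RiskKind) {l : ℝ → ℝ} (hl : IsLossFunction l)
    (hsf : k = RiskKind.sf → StrictMono l ∧ ∃ x, l x ≤ 1) {KF KG R : ℝ} (hK : 0 ≤ KF + R * KG) :
    ∃ M κ : ℝ, 0 ≤ M ∧ 0 < κ ∧ ∀ (e : ℕ) (𝒳 : Type*) [MeasurableSpace 𝒳]
      (F : 𝒳 → ℝ) (G : Fin e → 𝒳 → ℝ) (p : Fin e → ℝ) (𝒢 : Set (EuclideanSpace ℝ (Fin e))),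
      Measurable F → (∀ i, Measurable (G i)) → (∀ x, |F x| ≤ KF) → (∀ x, ∑ i, |G i x| ≤ KG) →
      𝒢.Nonempty → (∀ g ∈ 𝒢, ‖g‖ ≤ R) → ∀ (μ ν : Measure 𝒳) [IsProbabilityMeasure μ]
        [IsProbabilityMeasure ν] (δ : ℝ), (∀ g ∈ 𝒢, ∀ m, |m| ≤ M →
          |∫ x, l (F x + ∑ i, g i * G i x - m) ∂μ - ∫ x, l (F x + ∑ i, g i * G i x - m) ∂ν| ≤ δ) →
        |hedgedRisk k l G p 𝒢 μ F - hedgedRisk k l G p 𝒢 ν F| ≤ κ * δ := by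
  obtain ⟨M, κ, hM, hκ, h⟩ := exists_riskMeasure_stability k hl hsf hK
  refine ⟨M, κ, hM, hκ, fun e 𝒳 _ F G p 𝒢 hF hG hFb hGb hne hR μ ν _ _ δ hδ => ?_⟩
  have : Nonempty 𝒢 := hne.to_subtype
  have hsplit : ∀ (μ : Measure 𝒳) (g : 𝒢), riskMeasure k l μ
      (fun x => F x + ∑ i, (g : EuclideanSpace ℝ (Fin e)) i * (G i x - p i)) = riskMeasure k l μ
      (fun x => (F x + ∑ i, (g : EuclideanSpace ℝ (Fin e)) i * G i x)
        + -∑ i, (g : EuclideanSpace ℝ (Fin e)) i * p i) := by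
    intro μ g
    congr 1
    ext x
    simp only [mul_sub, Finset.sum_sub_distrib]
    ring
  have hHm : ∀ g : 𝒢, Measurable fun x => F x + ∑ i, (g : EuclideanSpace ℝ (Fin e)) i * G i x :=
    fun g => hF.add (Finset.measurable_fun_sum _ fun i _ => (hG i).const_mul _)
  have hHb : ∀ (g : 𝒢) x, |F x + ∑ i, (g : EuclideanSpace ℝ (Fin e)) i * G i x| ≤ KF + R * KG :=
    fun g x => (abs_add_le _ _).trans
      (add_le_add (hFb x) (abs_sum_mul_le_of_norm_le (hR g g.2) (hGb x)))
  have hbdd : ∀ (μ : Measure 𝒳) [IsProbabilityMeasure μ],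
      BddBelow (Set.range fun g : 𝒢 => riskMeasure k l μ
        (fun x => F x + ∑ i, (g : EuclideanSpace ℝ (Fin e)) i * (G i x - p i))) := by
    intro μ _
    refine ⟨-(R * ∑ i, |p i|) - M, ?_⟩
    rintro _ ⟨g, rfl⟩
    simp only
    rw [hsplit]
    have h1 := (h 𝒳 _ (hHm g) (hHb g) μ (-∑ i, (g : EuclideanSpace ℝ (Fin e)) i * p i)).1
    have h2 := abs_sum_mul_le_of_norm_le (hR g g.2) (le_refl (∑ i, |p i|))
    linarith [(abs_le.1 h2).2]
  have hdiff : ∀ g : 𝒢, |riskMeasure k l μ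
        (fun x => F x + ∑ i, (g : EuclideanSpace ℝ (Fin e)) i * (G i x - p i))
      - riskMeasure k l ν
        (fun x => F x + ∑ i, (g : EuclideanSpace ℝ (Fin e)) i * (G i x - p i))| ≤ κ * δ := by
    intro g
    rw [hsplit, hsplit]
    exact (h 𝒳 _ (hHm g) (hHb g) μ _).2 ν δ (hδ g g.2)
  unfold hedgedRisk
  rw [abs_le]
  constructor
  · rw [neg_le_sub_iff_le_add, add_comm, ← sub_le_iff_le_add']
    refine le_ciInf fun g => ?_
    linarith [ciInf_le (hbdd ν) g, (abs_le.1 (hdiff g)).1]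
  · rw [sub_le_iff_le_add, ← sub_le_iff_le_add']
    refine le_ciInf fun g => ?_
    linarith [ciInf_le (hbdd μ) g, (abs_le.1 (hdiff g)).2]

theorem isProbabilityMeasure_empiricalMeasure {Ω 𝒳 : Type*} [MeasurableSpace 𝒳] (S : ℕ → Ω → 𝒳)
    {N : ℕ} (hN : 1 ≤ N) (ω : Ω) : IsProbabilityMeasure (empiricalMeasure S N ω) := by
  refine ⟨?_⟩
  simp only [empiricalMeasure, Measure.smul_apply, Measure.finsetSum_apply, measure_univ,
    Finset.sum_const, Finset.card_range, nsmul_eq_mul, mul_one, smul_eq_mul]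
  exact ENNReal.inv_mul_cancel (by exact_mod_cast (by omega : N ≠ 0)) (ENNReal.natCast_ne_top N)

theorem integral_empiricalMeasure {Ω 𝒳 : Type*} [MeasurableSpace 𝒳] (S : ℕ → Ω → 𝒳) (N : ℕ)
    (ω : Ω) {f : 𝒳 → ℝ} (hf : Measurable f) :
    ∫ x, f x ∂(empiricalMeasure S N ω) = (N : ℝ)⁻¹ * ∑ n ∈ Finset.range N, f (S n ω) := by
  rw [empiricalMeasure, integral_smul_measure, integral_finsetSum_measure]
  · simp [integral_dirac' _ _ hf.stronglyMeasurable]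
  · intro n _
    exact (integrable_dirac' hf.stronglyMeasurable (by simp))

theorem measurable_of_abs_sub_le_dist {Ω X : Type*} [MeasurableSpace Ω] [PseudoMetricSpace X]
    [MeasurableSpace X] [OpensMeasurableSpace X] {h : Ω → ℝ} {W : Ω → X} (hW : Measurable W)
    {C : ℝ} (hC : ∀ ω ω', |h ω - h ω'| ≤ C * dist (W ω) (W ω')) : Measurable h := by
  rcases isEmpty_or_nonempty Ω with hΩ | hΩ
  · exact measurable_of_empty h
  set r : X → Ω := Function.invFun W with hr
  have hrW : ∀ ω, W (r (W ω)) = W ω := fun ω => Function.invFun_eq ⟨ω, rfl⟩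
  have hlip : LipschitzOnWith C.toNNReal (h ∘ r) (Set.range W) := by
    refine LipschitzOnWith.of_dist_le_mul ?_
    rintro _ ⟨ω, rfl⟩ _ ⟨ω', rfl⟩
    have := hC (r (W ω)) (r (W ω'))
    rw [hrW, hrW] at this
    exact this.trans (mul_le_mul_of_nonneg_right (Real.le_coe_toNNReal C) dist_nonneg)
  obtain ⟨g, hg, hgeq⟩ := hlip.extend_real
  have : h = g ∘ W := by
    ext ω
    have h1 := hgeq ⟨ω, rfl⟩
    have h2 := hC (r (W ω)) ω
    rw [hrW, dist_self, mul_zero] at h2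
    have h3 := sub_eq_zero.1 (abs_eq_zero.1 (le_antisymm h2 (abs_nonneg _)))
    rw [Function.comp_apply, ← h1, Function.comp_apply, h3]
  rw [this]
  exact hg.continuous.measurable.comp hW

section Concentration

variable {Ω : Type*} [MeasurableSpace Ω] {P : Measure Ω} {X : Ω → ℝ} {a q : ℝ} {N : ℕ}

theorem measureReal_le_of_lintegral_exp_le (hX : Measurable X) (ha : 0 ≤ a) (hq : 0 < q)
    (hN : 1 ≤ N) (hexp : ∀ s, 0 ≤ s → ∫⁻ ω, ENNReal.ofReal (Real.exp (s * X ω)) ∂P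
      ≤ ENNReal.ofReal (a * Real.exp (s ^ 2 * q / N))) {ε : ℝ} (hε : 0 < ε) :
    P.real {ω | ε ≤ X ω} ≤ a * Real.exp (-(1 / (4 * q) * N * ε ^ 2)) := by
  have hN0 : (0 : ℝ) < N := by exact_mod_cast hN
  set s : ℝ := N * ε / (2 * q) with hs
  have hs0 : 0 ≤ s := by positivity
  have h1 : ENNReal.ofReal (Real.exp (s * ε)) * P {ω | ε ≤ X ω}
      ≤ ENNReal.ofReal (a * Real.exp (s ^ 2 * q / N)) := by
    refine le_trans ?_ ((mul_meas_ge_le_lintegral₀ (Measurable.aemeasurable (by fun_prop))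
      (ENNReal.ofReal (Real.exp (s * ε)))).trans (hexp s hs0))
    gcongr
    intro hω
    exact ENNReal.ofReal_le_ofReal (Real.exp_le_exp.2 (mul_le_mul_of_nonneg_left hω hs0))
  have h2 := ENNReal.toReal_mono ENNReal.ofReal_ne_top h1
  rw [ENNReal.toReal_mul, ENNReal.toReal_ofReal (Real.exp_pos _).le,
    ENNReal.toReal_ofReal (by positivity)] at h2
  have h3 : -(1 / (4 * q) * N * ε ^ 2) = s ^ 2 * q / N - s * ε := by
    rw [hs]; field_simp; ring
  rw [h3, Real.exp_sub, ← mul_div_assoc, le_div_iff₀ (Real.exp_pos _), mul_comm]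
  exact h2

theorem integrable_and_integral_le_of_lintegral_exp_le (hX : Measurable X) (hX0 : ∀ ω, 0 ≤ X ω)
    (ha : 0 ≤ a) (hN : 1 ≤ N)
    (hexp : ∀ s, 0 ≤ s → ∫⁻ ω, ENNReal.ofReal (Real.exp (s * X ω)) ∂P
      ≤ ENNReal.ofReal (a * Real.exp (s ^ 2 * q / N))) :
    Integrable X P ∧ ∫ ω, X ω ∂P ≤ a * Real.exp q / √(N : ℝ) := by
  have hN0 : (0 : ℝ) < √(N : ℝ) := Real.sqrt_pos.2 (by exact_mod_cast hN)
  have h1 := hexp (√N) hN0.le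
  rw [Real.sq_sqrt (Nat.cast_nonneg N), mul_div_cancel_left₀ q
    (by exact_mod_cast (by omega : N ≠ 0))] at h1
  have hbound : ∀ ω, X ω ≤ Real.exp (√N * X ω) / √N := fun ω => by
    rw [le_div_iff₀ hN0, mul_comm]
    linarith [Real.add_one_le_exp (√N * X ω)]
  have hlin : ∫⁻ ω, ENNReal.ofReal (X ω) ∂P ≤ ENNReal.ofReal (a * Real.exp q / √N) := by
    calc _ ≤ ∫⁻ ω, ENNReal.ofReal (1 / √N) * ENNReal.ofReal (Real.exp (√N * X ω)) ∂P :=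
          lintegral_mono fun ω => by
            rw [← ENNReal.ofReal_mul (by positivity)]
            refine ENNReal.ofReal_le_ofReal ((hbound ω).trans (le_of_eq (by ring)))
      _ ≤ ENNReal.ofReal (1 / √N) * ENNReal.ofReal (a * Real.exp q) := by
          rw [lintegral_const_mul' _ _ ENNReal.ofReal_ne_top]
          gcongr
      _ = _ := by
          rw [← ENNReal.ofReal_mul (by positivity)]
          congr 1; ring
  refine ⟨⟨hX.aestronglyMeasurable, ?_⟩, ?_⟩
  · rw [hasFiniteIntegral_iff_ofReal (.of_forall hX0)]
    exact hlin.trans_lt ENNReal.ofReal_lt_top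
  · rw [integral_eq_lintegral_of_nonneg_ae (.of_forall hX0) hX.aestronglyMeasurable]
    exact ENNReal.toReal_le_of_le_ofReal (by positivity) hlin

end Concentration

theorem abs_comp_inner_le {E : Type*} [NormedAddCommGroup E] [InnerProductSpace ℝ E] {φ : ℝ → ℝ}
    {L : ℝ} (hφ : ∀ x y, |φ x - φ y| ≤ L * |x - y|) (hL : 0 ≤ L) {t v : E} {B K : ℝ}
    (ht : ‖t‖ ≤ B) (hv : ‖v‖ ≤ K) : |φ (inner ℝ t v)| ≤ |φ 0| + L * (B * K) := by
  have h1 := hφ (inner ℝ t v) 0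
  have h2 : |inner ℝ t v| ≤ B * K := (abs_real_inner_le_norm _ _).trans
    (mul_le_mul ht hv (norm_nonneg _) ((norm_nonneg _).trans ht))
  rw [sub_zero] at h1
  have h3 := mul_le_mul_of_nonneg_left h2 hL
  linarith [abs_sub_abs_le_abs_sub (φ (inner ℝ t v)) (φ 0)]

/-- Exponential moments of the one-sided empirical process indexed by Lipschitz images of a
sequence of bounded linear functionals. -/
theorem lintegral_exp_mul_iSup_empirical_le {Ω 𝒳 E : Type*} [MeasurableSpace Ω]
    [MeasurableSpace 𝒳] [NormedAddCommGroup E] [InnerProductSpace ℝ E] {P : Measure Ω}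
    [IsProbabilityMeasure P] {μ : Measure 𝒳} [IsProbabilityMeasure μ] {S : ℕ → Ω → 𝒳}
    (hSm : ∀ n, Measurable (S n)) (hS : iIndepFun S P) (hSμ : ∀ n, P.map (S n) = μ) {V : 𝒳 → E}
    (hVm : ∀ y : E, Measurable fun x => inner ℝ y (V x)) {K B : ℝ} (hB : 0 ≤ B)
    (hV : ∀ x, ‖V x‖ ≤ K) {t : ℕ → E} (ht : ∀ i, ‖t i‖ ≤ B) {φ : ℝ → ℝ} {L : ℝ} (hL : 0 ≤ L)
    (hφm : Measurable φ) (hφ : ∀ x y, |φ x - φ y| ≤ L * |x - y|) {N : ℕ} (hN : 1 ≤ N) {s : ℝ}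
    (hs : 0 ≤ s) :
    ∫⁻ ω, ENNReal.ofReal (Real.exp (s * ⨆ i, (∫ x, φ (inner ℝ (t i) (V x)) ∂μ
        - ∫ x, φ (inner ℝ (t i) (V x)) ∂(empiricalMeasure S N ω)))) ∂P
      ≤ ENNReal.ofReal (2 * Real.exp (2 * (s * L * B * K) ^ 2 / N)) := by
  have hN0 : (0 : ℝ) < N := by exact_mod_cast hN
  set r : ℝ := s / N with hr
  have hr0 : 0 ≤ r := by positivity
  have hgm : ∀ i, Measurable fun x => φ (inner ℝ (t i) (V x)) := fun i => hφm.comp (hVm (t i))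
  set f : ℕ → 𝒳 → ℝ := fun i x => r * (φ (inner ℝ (t i) (V x)) - φ 0) with hf
  have hfm : ∀ i, Measurable (f i) := fun i => ((hgm i).sub_const _).const_mul r
  have hrL : ∀ x y, |r * (φ x - φ y)| ≤ |r * L * x - r * L * y| := fun x y => by
    rw [← mul_sub, abs_mul, abs_mul, abs_mul, abs_of_nonneg hL, mul_assoc]
    exact mul_le_mul_of_nonneg_left (hφ x y) (abs_nonneg _)
  have key := lintegral_pi_exp_iSup_le μ hVm (B := r * L * B) (t := fun i => (r * L) • t i)
    (f := f) (by positivity) hV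
    (fun i => by
      rw [norm_smul, Real.norm_of_nonneg (by positivity)]
      exact mul_le_mul_of_nonneg_left (ht i) (by positivity)) hfm
    (fun i x => by simpa [hf, real_inner_smul_left] using hrL (inner ℝ (t i) (V x)) 0)
    (fun i j x => by
      simpa [hf, real_inner_smul_left, ← mul_sub] using
        hrL (inner ℝ (t i) (V x)) (inner ℝ (t j) (V x))) N 0
  have hgint : ∀ i, Integrable (fun x => φ (inner ℝ (t i) (V x))) μ := fun i =>
    .of_bound (hgm i).aestronglyMeasurable (|φ 0| + L * (B * K)) (.of_forall fun x =>
      abs_comp_inner_le hφ hL (ht i) (hV x))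
  have hEf : ∀ i, ∫ x, f i x ∂μ = r * (∫ x, φ (inner ℝ (t i) (V x)) ∂μ - φ 0) := fun i => by
    rw [hf]
    simp only
    rw [integral_const_mul, integral_sub (hgint i) (integrable_const _), integral_const,
      probReal_univ, one_smul]
  have hmap : P.map (fun ω (n : Fin N) => S n ω) = Measure.pi fun _ => μ := by
    have h1 := hS.precomp (g := fun n : Fin N => (n : ℕ)) Fin.val_injective
    rw [iIndepFun_iff_map_fun_eq_pi_map fun n => (hSm _).aemeasurable] at h1
    simpa only [hSμ] using h1
  have hmeas : Measurable fun x : Fin N → 𝒳 => ENNReal.ofReal (Real.exp (⨆ i,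
      (inner ℝ ((r * L) • t i) (0 : E) + ∑ n, (∫ z, f i z ∂μ - f i (x n))))) := by
    refine ENNReal.measurable_ofReal.comp (Real.measurable_exp.comp (.iSup fun i => ?_))
    have := hfm i
    fun_prop
  rw [← hmap, lintegral_map hmeas (measurable_pi_lambda _ fun n => hSm n)] at key
  refine le_trans (le_of_eq ?_) (key.trans (le_of_eq ?_))
  · refine lintegral_congr fun ω => ?_
    rw [Real.mul_iSup_of_nonneg hs]
    congr 3
    ext i
    rw [integral_empiricalMeasure S N ω (hgm i), inner_zero_right, zero_add, hEf,
      Finset.sum_sub_distrib, Finset.sum_const, Finset.card_univ, Fintype.card_fin, nsmul_eq_mul,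
      Fin.sum_univ_eq_sum_range (fun n => f i (S n ω)), hf]
    simp only
    rw [← Finset.mul_sum, Finset.sum_sub_distrib, Finset.sum_const, Finset.card_range,
      nsmul_eq_mul, hr]
    field_simp
    ring
  · congr 1
    rw [smul_zero, norm_zero, Real.cosh_zero, mul_one, ← Real.exp_nat_mul, hr]
    congr 2
    field_simp

/-- The feature vector `(-1, F, G)` of a hedging problem. -/
noncomputable def hedgeFeature {e : ℕ} {𝒳 : Type*} (F : 𝒳 → ℝ) (G : Fin e → 𝒳 → ℝ) (x : 𝒳) :
    EuclideanSpace ℝ (Fin (e + 2)) :=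
  WithLp.toLp 2 (Fin.cons (-1) (Fin.cons (F x) fun i => G i x))

/-- The parameter vector `(m, 1, g)` of a strategy `g` and a cash amount `m`. -/
noncomputable def hedgeParam {e : ℕ} (m : ℝ) (g : EuclideanSpace ℝ (Fin e)) :
    EuclideanSpace ℝ (Fin (e + 2)) :=
  WithLp.toLp 2 (Fin.cons m (Fin.cons 1 fun i => g i))

section Hedge

variable {e : ℕ} {𝒳 : Type*} {F : 𝒳 → ℝ} {G : Fin e → 𝒳 → ℝ}

theorem inner_hedgeParam_hedgeFeature (m : ℝ) (g : EuclideanSpace ℝ (Fin e)) (x : 𝒳) :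
    inner ℝ (hedgeParam m g) (hedgeFeature F G x) = F x + ∑ i, g i * G i x - m := by
  simp only [hedgeParam, hedgeFeature, PiLp.inner_apply, Fin.sum_univ_succ, Fin.cons_zero,
    Fin.cons_succ, RCLike.inner_apply, conj_trivial, mul_comm]
  ring

theorem norm_hedgeParam_le {m M R : ℝ} {g : EuclideanSpace ℝ (Fin e)} (hm : |m| ≤ M)
    (hg : ‖g‖ ≤ R) : ‖hedgeParam m g‖ ≤ √(M ^ 2 + 1 + R ^ 2) := by
  apply Real.le_sqrt_of_sq_le
  rw [EuclideanSpace.norm_sq_eq]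
  simp only [hedgeParam, Fin.sum_univ_succ, Fin.cons_zero, Fin.cons_succ]
  have h1 := pow_le_pow_left₀ (norm_nonneg _) hg 2
  rw [EuclideanSpace.norm_sq_eq] at h1
  have h2 := pow_le_pow_left₀ (abs_nonneg _) hm 2
  rw [Real.norm_eq_abs, norm_one]
  linarith

theorem norm_hedgeFeature_le {KF KG : ℝ} {x : 𝒳} (hF : |F x| ≤ KF) (hG : ∑ i, |G i x| ≤ KG) :
    ‖hedgeFeature F G x‖ ≤ √(1 + KF ^ 2 + KG ^ 2) := by
  apply Real.le_sqrt_of_sq_le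
  rw [EuclideanSpace.norm_sq_eq]
  simp only [hedgeFeature, Fin.sum_univ_succ, Fin.cons_zero, Fin.cons_succ]
  have h1 := pow_le_pow_left₀ (abs_nonneg _) hF 2
  have h2 := pow_le_pow_left₀ (Finset.sum_nonneg fun i _ => abs_nonneg (G i x)) hG 2
  have h3 := Finset.sum_sq_le_sq_sum_of_nonneg (s := Finset.univ) (f := fun i => |G i x|)
    fun i _ => abs_nonneg (G i x)
  simp only [Real.norm_eq_abs, abs_neg, abs_one] at *
  linarith

theorem measurable_hedgeFeature [MeasurableSpace 𝒳] (hF : Measurable F)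
    (hG : ∀ i, Measurable (G i)) : Measurable (hedgeFeature F G) := by
  refine (WithLp.measurable_toLp 2 _).comp (measurable_pi_lambda _ fun i => ?_)
  refine Fin.cases ?_ (fun i => Fin.cases ?_ (fun i => ?_) i) i
  · exact measurable_const
  · exact hF
  · exact hG i

end Hedge

theorem continuous_integral_comp_inner {𝒳 E : Type*} [MeasurableSpace 𝒳] [NormedAddCommGroup E]
    [InnerProductSpace ℝ E] {μ : Measure 𝒳} [IsProbabilityMeasure μ] {V : 𝒳 → E}
    (hVm : ∀ y : E, Measurable fun x => inner ℝ y (V x)) {K B : ℝ} (hV : ∀ x, ‖V x‖ ≤ K)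
    {T : Set E} (hT : ∀ t ∈ T, ‖t‖ ≤ B) {φ : ℝ → ℝ} {L : ℝ} (hL : 0 ≤ L)
    (hφc : Continuous φ) (hφ : ∀ x y, |φ x - φ y| ≤ L * |x - y|) :
    Continuous fun t : T => ∫ x, φ (inner ℝ (t : E) (V x)) ∂μ := by
  refine continuous_of_dominated (bound := fun _ => |φ 0| + L * (B * K))
    (fun t => (hφc.measurable.comp (hVm t)).aestronglyMeasurable) (fun t => .of_forall fun x =>
      abs_comp_inner_le hφ hL (hT t t.2) (hV x))
    (integrable_const _) (.of_forall fun x => by fun_prop)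

theorem abs_integral_empiricalMeasure_sub_le {Ω 𝒳 E : Type*} [MeasurableSpace 𝒳]
    [NormedAddCommGroup E] [InnerProductSpace ℝ E] (S : ℕ → Ω → 𝒳) {N : ℕ} (hN : 1 ≤ N)
    {V : 𝒳 → E} {t : E} (hVm : Measurable fun x => inner ℝ t (V x)) {B : ℝ} (ht : ‖t‖ ≤ B)
    {φ : ℝ → ℝ} {L : ℝ} (hL : 0 ≤ L) (hφm : Measurable φ)
    (hφ : ∀ x y, |φ x - φ y| ≤ L * |x - y|) (ω ω' : Ω) :
    |∫ x, φ (inner ℝ t (V x)) ∂(empiricalMeasure S N ω)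
        - ∫ x, φ (inner ℝ t (V x)) ∂(empiricalMeasure S N ω')|
      ≤ L * B * dist (fun n : Fin N => V (S n ω)) (fun n : Fin N => V (S n ω')) := by
  have hN0 : (0 : ℝ) < N := by exact_mod_cast hN
  have hm : Measurable fun x => φ (inner ℝ t (V x)) := hφm.comp hVm
  rw [integral_empiricalMeasure S N ω hm, integral_empiricalMeasure S N ω' hm, ← mul_sub,
    ← Finset.sum_sub_distrib, abs_mul, abs_of_pos (inv_pos.2 hN0),
    inv_mul_le_iff₀ hN0]
  calc _ ≤ ∑ n ∈ Finset.range N, |φ (inner ℝ t (V (S n ω))) - φ (inner ℝ t (V (S n ω')))| :=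
        Finset.abs_sum_le_sum_abs _ _
    _ ≤ ∑ _n ∈ Finset.range N, L * B *
        dist (fun n : Fin N => V (S n ω)) (fun n : Fin N => V (S n ω')) := by
        refine Finset.sum_le_sum fun n hn => (hφ _ _).trans ?_
        rw [← inner_sub_right, mul_assoc]
        refine mul_le_mul_of_nonneg_left ((abs_real_inner_le_norm _ _).trans ?_) hL
        have h1 := dist_le_pi_dist (fun n : Fin N => V (S n ω)) (fun n : Fin N => V (S n ω'))
          ⟨n, Finset.mem_range.1 hn⟩
        rw [dist_eq_norm] at h1
        exact mul_le_mul ht h1 (norm_nonneg _) ((norm_nonneg _).trans ht)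
    _ = _ := by simp

/-- Exponential moments of a random variable dominated by a uniform deviation over a family of
bounded linear functionals composed with a Lipschitz function. -/
theorem lintegral_exp_le_of_uniform_deviation {Ω 𝒳 E : Type*} [MeasurableSpace Ω]
    [MeasurableSpace 𝒳] [NormedAddCommGroup E] [InnerProductSpace ℝ E]
    [SecondCountableTopology E] {P : Measure Ω}
    [IsProbabilityMeasure P] {μ : Measure 𝒳} [IsProbabilityMeasure μ] {S : ℕ → Ω → 𝒳}
    (hSm : ∀ n, Measurable (S n)) (hS : iIndepFun S P) (hSμ : ∀ n, P.map (S n) = μ) {V : 𝒳 → E}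
    (hVm : ∀ y : E, Measurable fun x => inner ℝ y (V x)) {K B : ℝ} (hB : 0 ≤ B)
    (hV : ∀ x, ‖V x‖ ≤ K) {T : Set E} (hTne : T.Nonempty) (hT : ∀ t ∈ T, ‖t‖ ≤ B) {φ : ℝ → ℝ}
    {L : ℝ} (hL : 0 ≤ L) (hφc : Continuous φ) (hφ : ∀ x y, |φ x - φ y| ≤ L * |x - y|) {N : ℕ}
    (hN : 1 ≤ N) {κ : ℝ} (hκ : 0 ≤ κ) {X : Ω → ℝ} (hX : ∀ ω δ,
      (∀ t ∈ T, |∫ x, φ (inner ℝ t (V x)) ∂μ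
        - ∫ x, φ (inner ℝ t (V x)) ∂(empiricalMeasure S N ω)| ≤ δ) → X ω ≤ κ * δ)
    {s : ℝ} (hs : 0 ≤ s) :
    ∫⁻ ω, ENNReal.ofReal (Real.exp (s * X ω)) ∂P
      ≤ ENNReal.ofReal (4 * Real.exp (s ^ 2 * (2 * (κ * L * B * K) ^ 2) / N)) := by
  have : Nonempty T := hTne.to_subtype
  set t : ℕ → E := fun i => (TopologicalSpace.denseSeq T i : E) with ht_def
  have ht : ∀ i, ‖t i‖ ≤ B := fun i => hT _ (TopologicalSpace.denseSeq T i).2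
  set d : E → Ω → ℝ := fun y ω => ∫ x, φ (inner ℝ y (V x)) ∂μ
        - ∫ x, φ (inner ℝ y (V x)) ∂(empiricalMeasure S N ω) with hd
  have hφn : ∀ x y, |-φ x - -φ y| ≤ L * |x - y| := fun x y => by
    rw [neg_sub_neg, abs_sub_comm]; exact hφ x y
  have h1 := lintegral_exp_mul_iSup_empirical_le hSm hS hSμ hVm hB hV ht hL hφc.measurable hφ hN
    (mul_nonneg hs hκ)
  have h2 := lintegral_exp_mul_iSup_empirical_le hSm hS hSμ hVm hB hV ht hL
    hφc.neg.measurable hφn hN (mul_nonneg hs hκ)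
  have hbdd : ∀ ω, ∃ C, ∀ y ∈ T, |d y ω| ≤ C := by
    intro ω
    have := isProbabilityMeasure_empiricalMeasure S hN ω
    have hone : ∀ (ν : Measure 𝒳) [IsProbabilityMeasure ν], ∀ y ∈ T,
        |∫ x, φ (inner ℝ y (V x)) ∂ν| ≤ |φ 0| + L * (B * K) := by
      intro ν _ y hy
      have := norm_integral_le_of_norm_le_const (μ := ν) (f := fun x => φ (inner ℝ y (V x)))
        (C := |φ 0| + L * (B * K)) (.of_forall fun x =>
          abs_comp_inner_le hφ hL (hT y hy) (hV x))
      simpa using this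
    exact ⟨_, fun y hy => (abs_sub _ _).trans (add_le_add (hone μ y hy)
      (hone (empiricalMeasure S N ω) y hy))⟩
  have hpt : ∀ ω, Real.exp (s * X ω) ≤ Real.exp (s * κ * ⨆ i, d (t i) ω)
      + Real.exp (s * κ * ⨆ i, -d (t i) ω) := by
    intro ω
    have := isProbabilityMeasure_empiricalMeasure S hN ω
    obtain ⟨C, hC⟩ := hbdd ω
    have hCt : ∀ i, |d (t i) ω| ≤ C := fun i => hC _ (TopologicalSpace.denseSeq T i).2
    set p := ⨆ i, d (t i) ω
    set n := ⨆ i, -d (t i) ω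
    have hp : ∀ i, d (t i) ω ≤ p := fun i => le_ciSup (f := fun i => d (t i) ω)
      ⟨C, by rintro _ ⟨j, rfl⟩; exact (le_abs_self _).trans (hCt j)⟩ i
    have hn : ∀ i, -d (t i) ω ≤ n := fun i => le_ciSup (f := fun i => -d (t i) ω)
      ⟨C, by rintro _ ⟨j, rfl⟩; exact (neg_le_abs _).trans (hCt j)⟩ i
    have hcont : Continuous fun y : T => |d y ω| :=
      ((continuous_integral_comp_inner hVm hV hT hL hφc hφ).sub
        (continuous_integral_comp_inner hVm hV hT hL hφc hφ)).abs
    have hall : ∀ y ∈ T, |d y ω| ≤ max p n := fun y hy =>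
      (TopologicalSpace.denseRange_denseSeq T).induction_on (p := fun y : T => |d y ω| ≤ max p n)
        ⟨y, hy⟩ (isClosed_le hcont continuous_const) fun i =>
          abs_le'.2 ⟨(hp i).trans (le_max_left _ _), (hn i).trans (le_max_right _ _)⟩
    have hXω := mul_le_mul_of_nonneg_left (hX ω _ hall) hs
    rw [← mul_assoc] at hXω
    rcases max_choice p n with h | h <;> rw [h] at hXω
    · linarith [Real.exp_le_exp.2 hXω, Real.exp_pos (s * κ * n)]
    · linarith [Real.exp_le_exp.2 hXω, Real.exp_pos (s * κ * p)]
  have hdm : ∀ i, Measurable (d (t i)) := by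
    intro i
    have hm : Measurable fun x => φ (inner ℝ (t i) (V x)) := hφc.measurable.comp (hVm _)
    simp only [hd]
    simp_rw [fun ω => integral_empiricalMeasure S N ω hm]
    exact ((Finset.measurable_fun_sum _ fun n _ => hm.comp (hSm n)).const_mul _).const_sub _
  have hpm : Measurable fun ω => ENNReal.ofReal (Real.exp (s * κ * ⨆ i, d (t i) ω)) :=
    ((Measurable.iSup hdm).const_mul _).exp.ennreal_ofReal
  calc _ ≤ ∫⁻ ω, (ENNReal.ofReal (Real.exp (s * κ * ⨆ i, d (t i) ω))
        + ENNReal.ofReal (Real.exp (s * κ * ⨆ i, -d (t i) ω))) ∂P :=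
        lintegral_mono fun ω => by
          rw [← ENNReal.ofReal_add (Real.exp_pos _).le (Real.exp_pos _).le]
          exact ENNReal.ofReal_le_ofReal (hpt ω)
    _ = ∫⁻ ω, ENNReal.ofReal (Real.exp (s * κ * ⨆ i, d (t i) ω)) ∂P
        + ∫⁻ ω, ENNReal.ofReal (Real.exp (s * κ * ⨆ i, -d (t i) ω)) ∂P :=
        lintegral_add_left hpm _
    _ ≤ ENNReal.ofReal (2 * Real.exp (2 * (s * κ * L * B * K) ^ 2 / N))
        + ENNReal.ofReal (2 * Real.exp (2 * (s * κ * L * B * K) ^ 2 / N)) := by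
        refine add_le_add h1 ?_
        simp only [Pi.neg_apply, integral_neg, neg_sub_neg] at h2
        simpa only [hd, neg_sub] using h2
    _ = _ := by
        rw [← ENNReal.ofReal_add (by positivity) (by positivity), ← two_mul, ← mul_assoc]
        congr 1
        norm_num
        ring_nf


theorem mainTheorem1 (k : RiskKind) (l : ℝ → ℝ) (hl : IsLossFunction l)
    (hsf : k = RiskKind.sf → StrictMono l ∧ ∃ x, l x ≤ 1)
    (KF KG R : ℝ) :
    ∃ c C : ℝ, 0 < c ∧ 0 < C ∧
      ∀ (e : ℕ) (𝒳 : Type*) [MeasurableSpace 𝒳] (μ : Measure 𝒳) [IsProbabilityMeasure μ]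
        (F : 𝒳 → ℝ) (G : Fin e → 𝒳 → ℝ) (p : Fin e → ℝ)
        (𝒢 : Set (EuclideanSpace ℝ (Fin e)))
        (Ω : Type*) [MeasurableSpace Ω] (P : Measure Ω) [IsProbabilityMeasure P]
        (S : ℕ → Ω → 𝒳),
        Measurable F → (∀ i, Measurable (G i)) →
        (∀ x, |F x| ≤ KF) → (∀ x, ∑ i, |G i x| ≤ KG) →
        𝒢.Nonempty → (∀ g ∈ 𝒢, ‖g‖ ≤ R) →
        (∀ n, Measurable (S n)) → iIndepFun S P → (∀ n, P.map (S n) = μ) →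
        (∀ N : ℕ, 1 ≤ N →
          Integrable (fun ω => |hedgedRisk k l G p 𝒢 μ F
            - hedgedRisk k l G p 𝒢 (empiricalMeasure S N ω) F|) P ∧
          ∫ ω, |hedgedRisk k l G p 𝒢 μ F
            - hedgedRisk k l G p 𝒢 (empiricalMeasure S N ω) F| ∂P ≤ C / √(N : ℝ)) ∧
        (∀ N : ℕ, 1 ≤ N → ∀ ε : ℝ, 0 < ε →
          P.real {ω | ε ≤ |hedgedRisk k l G p 𝒢 μ F
            - hedgedRisk k l G p 𝒢 (empiricalMeasure S N ω) F|}
            ≤ C * Real.exp (-(c * (N : ℝ) * ε ^ 2))) := by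
  obtain ⟨M, κ, hM, hκ, hstab⟩ := exists_hedgedRisk_stability k hl hsf
    (KF := |KF|) (KG := |KG|) (R := |R|) (by positivity)
  set A : ℝ := |KF| + |R| * |KG| + M with hA
  set L : ℝ := l (A + 1) - l A with hLdef
  have hL : 0 ≤ L := sub_nonneg.2 (hl.mono (le_add_of_nonneg_right zero_le_one))
  set φ : ℝ → ℝ := fun z => l (min z A) with hφdef
  have hφ : ∀ x y, |φ x - φ y| ≤ L * |x - y| := fun x y =>
    (hl.abs_sub_le (min_le_right x A) (min_le_right y A)).trans
      (mul_le_mul_of_nonneg_left (by simpa using abs_min_sub_min_le_max x A y A) hL)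
  have hφc : Continuous φ :=
    (LipschitzWith.of_dist_le_mul (K := ⟨L, hL⟩) fun x y => hφ x y).continuous
  set B : ℝ := √(M ^ 2 + 1 + |R| ^ 2) with hBdef
  set K : ℝ := √(1 + |KF| ^ 2 + |KG| ^ 2) with hKdef
  have hB : 0 ≤ B := Real.sqrt_nonneg _
  set q : ℝ := 2 * (κ * L * B * K) ^ 2 + 1 with hqdef
  have hq : 0 < q := by positivity
  refine ⟨1 / (4 * q), 4 * Real.exp q, by positivity, by positivity, ?_⟩
  intro e 𝒳 _ μ _ F G p 𝒢 Ω _ P _ S hF hG hFb hGb hne hR hSm hS hSμ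
  replace hFb : ∀ x, |F x| ≤ |KF| := fun x => (hFb x).trans (le_abs_self KF)
  replace hGb : ∀ x, ∑ i, |G i x| ≤ |KG| := fun x => (hGb x).trans (le_abs_self KG)
  replace hR : ∀ g ∈ 𝒢, ‖g‖ ≤ |R| := fun g hg => (hR g hg).trans (le_abs_self R)
  set V : 𝒳 → EuclideanSpace ℝ (Fin (e + 2)) := hedgeFeature F G with hVdef
  have hVmeas : Measurable V := measurable_hedgeFeature hF hG
  have hVm : ∀ y, Measurable fun x => inner ℝ y (V x) := fun y =>
    (continuous_const.inner continuous_id).measurable.comp hVmeas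
  have hV : ∀ x, ‖V x‖ ≤ K := fun x => norm_hedgeFeature_le (hFb x) (hGb x)
  set T : Set (EuclideanSpace ℝ (Fin (e + 2))) := {t | ∃ m g, |m| ≤ M ∧ g ∈ 𝒢 ∧ t = hedgeParam m g}
    with hTdef
  have hT : ∀ t ∈ T, ‖t‖ ≤ B := by
    rintro _ ⟨m, g, hm, hg, rfl⟩
    exact norm_hedgeParam_le hm (hR g hg)
  have hTne : T.Nonempty := by
    obtain ⟨g, hg⟩ := hne
    exact ⟨hedgeParam 0 g, 0, g, by simpa using hM, hg, rfl⟩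
  have hstab' : ∀ (ν ν' : Measure 𝒳) [IsProbabilityMeasure ν] [IsProbabilityMeasure ν'] (δ : ℝ),
      (∀ t ∈ T, |∫ x, φ (inner ℝ t (V x)) ∂ν - ∫ x, φ (inner ℝ t (V x)) ∂ν'| ≤ δ) →
        |hedgedRisk k l G p 𝒢 ν F - hedgedRisk k l G p 𝒢 ν' F| ≤ κ * δ := by
    intro ν ν' _ _ δ hδ
    refine hstab e 𝒳 F G p 𝒢 hF hG hFb hGb hne hR ν ν' δ fun g hg m hm => ?_
    have h1 := hδ _ ⟨m, g, hm, hg, rfl⟩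
    have h2 : ∀ x, φ (inner ℝ (hedgeParam m g) (V x)) = l (F x + ∑ i, g i * G i x - m) := by
      intro x
      rw [inner_hedgeParam_hedgeFeature, hφdef]
      simp only
      rw [min_eq_left]
      have h3 := abs_sum_mul_le_of_norm_le (hR g hg) (hGb x)
      linarith [(abs_le.1 (hFb x)).2, (abs_le.1 h3).2, (abs_le.1 hm).1]
    simpa only [h2] using h1
  have hmeas : ∀ N : ℕ, 1 ≤ N →
      Measurable fun ω => hedgedRisk k l G p 𝒢 (empiricalMeasure S N ω) F := by
    intro N hN
    refine measurable_of_abs_sub_le_dist (W := fun ω (n : Fin N) => V (S n ω))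
      (measurable_pi_lambda _ fun n => hVmeas.comp (hSm n)) (C := κ * (L * B)) fun ω ω' => ?_
    have := isProbabilityMeasure_empiricalMeasure S hN ω
    have := isProbabilityMeasure_empiricalMeasure S hN ω'
    rw [mul_assoc]
    exact hstab' _ _ _ fun t ht =>
      abs_integral_empiricalMeasure_sub_le S hN (hVm t) (hT t ht) hL hφc.measurable hφ ω ω'
  have hexp : ∀ N : ℕ, 1 ≤ N → ∀ s : ℝ, 0 ≤ s → ∫⁻ ω, ENNReal.ofReal (Real.exp (s *
      |hedgedRisk k l G p 𝒢 μ F - hedgedRisk k l G p 𝒢 (empiricalMeasure S N ω) F|)) ∂P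
        ≤ ENNReal.ofReal (4 * Real.exp (s ^ 2 * q / N)) := by
    intro N hN s hs
    refine (lintegral_exp_le_of_uniform_deviation hSm hS hSμ hVm hB hV hTne hT hL hφc hφ hN hκ.le
      (fun ω δ hδ => ?_) hs).trans (ENNReal.ofReal_le_ofReal ?_)
    · have := isProbabilityMeasure_empiricalMeasure S hN ω
      exact hstab' _ _ _ hδ
    · gcongr
      exact (lt_add_one _).le
  refine ⟨fun N hN => integrable_and_integral_le_of_lintegral_exp_le
    ((hmeas N hN).const_sub _).abs (fun _ => abs_nonneg _) zero_le_four hN (hexp N hN),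
    fun N hN ε hε => ?_⟩
  refine (measureReal_le_of_lintegral_exp_le ((hmeas N hN).const_sub _).abs zero_le_four hq hN
    (hexp N hN) hε).trans ?_
  gcongr
  linarith [Real.one_le_exp hq.le]
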